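/- Let $\mathsf{CLKID}$ be Brotherston and Simpson's cyclic proof system for classical first-order logic with equality and inductive definitions. Its sequents are pairs $\Gamma\vdash\Delta$ of finite sets of formulas. Its rules are the axiom $\Gamma\vdash\Delta$ ($\Gamma\cap\Delta\neq\emptyset$), weakening, cut, substitution, the left and right rules for $\neg,\wedge,\vee,\to,\forall,\exists$, the rules $$\frac{\Gamma[x:=u,y:=t]\vdash\Delta[x:=u,y:=t]}{\Gamma[x:=t,y:=u],\,t=u\vdash\Delta[x:=t,y:=u]}\qquad\text{and}\qquad\frac{}{\Gamma\vdash t=t,\Delta}$$ for equality, and for each inductive predicate $P$ one right rule per production of $P$ and the case-split rule, which derives $\Gamma,P(\vec u)\vdash\Delta$ from all sequents $\Gamma,\vec u=\vec t(\vec y),A_1(\vec y),\dots,A_m(\vec y)\vdash\Delta$, one for each production of $P$ with assumptions $A_1(\vec x),\dots,A_m(\vec x)$ and conclusion $P(\vec t(\vec x))$, with fresh distinct variables $\vec y$. A $\mathsf{CLKID}$ pre-proof is a finite derivation tree, some of whose leaves are buds (leaves to which no rule is applied), together with a map from each bud to an inner (non-bud) node labelled with the same sequent. It is a proof if its infinite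 tree-unfolding satisfies the global trace condition: along some tail of every infinite path there is a trace of inductive predicates in the antecedents that is unfolded infinitely often by case-splits. A proof is cut-free if it contains no application of the cut rule. Consider a first-order language with (at least) two distinct constants $\mathsf s,\mathsf e$, a unary function symbol $\mathsf n$, and two distinct unary inductive predicate symbols $\mathrm{TeF},\mathrm{FsT}$, whose productions are exactly $$\frac{}{\mathrm{TeF}(\mathsf e)}\qquad\frac{\mathrm{TeF}(\mathsf n x)}{\mathrm{TeF}(x)}\qquad\qquad\frac{}{\mathrm{FsT}(\mathsf s)}\qquad\frac{\mathrm{FsT}(x)}{\mathrm{FsT}(\mathsf n x)}$$ (the language may contain further function symbols, ordinary predicates, and inductive predicates with productions of their own). Then: 1. the sequent $\mathrm{TeF}(\mathsf s)\vdash\mathrm{FsT}(\mathsf e)$ is provable in $\mathsf{CLKID}$; 2. the sequent $\mathrm{TeF}(\mathsf s)\vdash\mathrm{FsT}(\mathsf e)$ is not cut-free provable in $\mathsf{CLKID}$. Consequently $\mathsf{CLKID}$ does not have the cut-elimination property (every provable sequent is cut-free provable), even over the language whose only function symbols are $\mathsf s,\mathsf e,\mathsf n$ and whose only predicate symbols besides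 equality are the two unary inductive predicates $\mathrm{TeF},\mathrm{FsT}$. -/

import Mathlib

universe u v w

namespace CLKID

/-! ### First-order logic with inductive predicates

`L` provides the function symbols and the ordinary predicate symbols, `I n` is the type of
inductive predicate symbols of arity `n`. Terms are the terms of `L` over the variables `ℕ`. -/

/-- Formulas of first-order logic with inductive predicates. Bound variables are de Bruijn indices:
in the body of a quantifier, variable `0` is the bound one and variable `n + 1` is the variable `n`
of the context, so that formulas are identified up to renaming of bound variables. -/
inductive Fml (L : FirstOrder.Language.{u, v}) (I : ℕ → Type w) : Type (max u v w)
  | eq (t₁ t₂ : L.Term ℕ) : Fml L I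
  | ord {n : ℕ} (R : L.Relations n) (ts : Fin n → L.Term ℕ) : Fml L I
  | ind {n : ℕ} (P : I n) (ts : Fin n → L.Term ℕ) : Fml L I
  | neg (φ : Fml L I) : Fml L I
  | and (φ ψ : Fml L I) : Fml L I
  | or (φ ψ : Fml L I) : Fml L I
  | imp (φ ψ : Fml L I) : Fml L I
  | all (φ : Fml L I) : Fml L I
  | ex (φ : Fml L I) : Fml L I

section Syn

variable {L : FirstOrder.Language.{u, v}} {I : ℕ → Type w}

noncomputable instance : DecidableEq (Fml L I) := Classical.decEq _

/-- A substitution, pushed under a quantifier. -/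
def up (θ : ℕ → L.Term ℕ) : ℕ → L.Term ℕ
  | 0 => .var 0
  | n + 1 => (θ n).relabel Nat.succ

/-- The simultaneous capture-avoiding substitution `φ[θ]`. -/
def Fml.subst : Fml L I → (ℕ → L.Term ℕ) → Fml L I
  | .eq t₁ t₂, θ => .eq (t₁.subst θ) (t₂.subst θ)
  | .ord R ts, θ => .ord R fun i => (ts i).subst θ
  | .ind P ts, θ => .ind P fun i => (ts i).subst θ
  | .neg φ, θ => .neg (φ.subst θ)
  | .and φ ψ, θ => .and (φ.subst θ) (ψ.subst θ)
  | .or φ ψ, θ => .or (φ.subst θ) (ψ.subst θ)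
  | .imp φ ψ, θ => .imp (φ.subst θ) (ψ.subst θ)
  | .all φ, θ => .all (φ.subst (up θ))
  | .ex φ, θ => .ex (φ.subst (up θ))

/-- The instance `φ[t]` of the body `φ` of a quantifier. -/
def Fml.inst (φ : Fml L I) (t : L.Term ℕ) : Fml L I :=
  φ.subst fun
    | 0 => t
    | n + 1 => .var n

/-- The substitution `[x := t, y := u]` (used for `x ≠ y`). -/
def subst₂ (x : ℕ) (t : L.Term ℕ) (y : ℕ) (u : L.Term ℕ) : ℕ → L.Term ℕ :=
  fun z => if z = x then t else if z = y then u else .var z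

/-- The free variables of a formula. -/
def Fml.fv : Fml L I → Set ℕ
  | .eq t₁ t₂ => {x | x ∈ t₁.varFinset ∨ x ∈ t₂.varFinset}
  | .ord _ ts => {x | ∃ i, x ∈ (ts i).varFinset}
  | .ind _ ts => {x | ∃ i, x ∈ (ts i).varFinset}
  | .neg φ => φ.fv
  | .and φ ψ => φ.fv ∪ ψ.fv
  | .or φ ψ => φ.fv ∪ ψ.fv
  | .imp φ ψ => φ.fv ∪ ψ.fv
  | .all φ => {x | x + 1 ∈ φ.fv}
  | .ex φ => {x | x + 1 ∈ φ.fv}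

/-- `φ` is an atomic formula `P(t₁, …, tₙ)` with an inductive predicate symbol `P`. -/
def Fml.IsInd (φ : Fml L I) : Prop := ∃ (n : ℕ) (P : I n) (ts : Fin n → L.Term ℕ), φ = .ind P ts

end Syn

/-- A sequent `Γ ⊢ Δ`: a pair of finite sets of formulas. -/
structure Sequent (L : FirstOrder.Language.{u, v}) (I : ℕ → Type w) where
  ant : Finset (Fml L I)
  suc : Finset (Fml L I)

/-! ### Inductive definitions -/

/-- An assumption of a production, with variables from `α`. -/
inductive Atom (L : FirstOrder.Language.{u, v}) (I : ℕ → Type w) (α : Type) : Type (max u v w)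
  | ord {n : ℕ} (R : L.Relations n) (ts : Fin n → L.Term α) : Atom L I α
  | ind {n : ℕ} (P : I n) (ts : Fin n → L.Term α) : Atom L I α

/-- A production for an inductive predicate `P` of arity `n`, in the variables `Fin vars`:
from the assumptions `hyps` conclude `P(args)`. -/
structure Production (L : FirstOrder.Language.{u, v}) (I : ℕ → Type w) (n : ℕ) where
  vars : ℕ
  hyps : List (Atom L I (Fin vars))
  args : Fin n → L.Term (Fin vars)

/-- An inductive definition set: it gives each inductive predicate symbol the finite list
of its productions. -/
abbrev DefSet (L : FirstOrder.Language.{u, v}) (I : ℕ → Type w) := ∀ n : ℕ, I n → List (Production L I n)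

section Rules

variable {L : FirstOrder.Language.{u, v}} {I : ℕ → Type w}

/-- An assumption of a production, with terms put for its variables. -/
def Atom.inst {α : Type} (a : Atom L I α) (σ : α → L.Term ℕ) : Fml L I :=
  match a with
  | .ord R ts => .ord R fun i => (ts i).subst σ
  | .ind P ts => .ind P fun i => (ts i).subst σ

/-- The formulas which the case distinction for `P(us)` and the production `p` adds to the
antecedent, with `y` in the place of the variables of `p`. -/
noncomputable def Production.caseHyps {n : ℕ} (p : Production L I n) (us : Fin n → L.Term ℕ)
    (y : Fin p.vars → ℕ) : Finset (Fml L I) :=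
  (Finset.univ.image fun i => Fml.eq (us i) ((p.args i).subst fun j => .var (y j))) ∪
    (p.hyps.map fun a => a.inst fun j => .var (y j)).toFinset

end Rules

/-- Names of the inference rules. A name carries those data of an application of the rule
on which traces depend: the substitution of (Subst), the principal formula `t = u` of (=L), and
for (Case P) the principal formula `P(us)` and the fresh variables used for each production. -/
inductive Rule (L : FirstOrder.Language.{u, v}) (I : ℕ → Type w) : Type (max u v w)
  | ax | weak | cut
  | subst (θ : ℕ → L.Term ℕ)
  | negL | negR | andL | andR | orL | orR | impL | impR
  | allL | allR | exL | exR
  | eqL (t u : L.Term ℕ)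
  | eqR
  | indR {n : ℕ} (P : I n)
  | case {n : ℕ} (P : I n) (us : Fin n → L.Term ℕ) (ys : ∀ p : Production L I n, Fin p.vars → ℕ)

section Proofs

variable {L : FirstOrder.Language.{u, v}} {I : ℕ → Type w}

/-- `IsInstance Φ r prems S`: an application of the rule `r` leads from the assumptions `prems`
to the conclusion `S`. -/
inductive IsInstance (Φ : DefSet L I) : Rule L I → List (Sequent L I) → Sequent L I → Prop
  | ax (Γ Δ : Finset (Fml L I)) (φ : Fml L I) (hΓ : φ ∈ Γ) (hΔ : φ ∈ Δ) :
      IsInstance Φ .ax [] ⟨Γ, Δ⟩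
  | weak (Γ' Δ' Γ Δ : Finset (Fml L I)) (hΓ : Γ' ⊆ Γ) (hΔ : Δ' ⊆ Δ) :
      IsInstance Φ .weak [⟨Γ', Δ'⟩] ⟨Γ, Δ⟩
  | cut (Γ Δ : Finset (Fml L I)) (φ : Fml L I) :
      IsInstance Φ .cut [⟨Γ, insert φ Δ⟩, ⟨insert φ Γ, Δ⟩] ⟨Γ, Δ⟩
  | subst (Γ Δ : Finset (Fml L I)) (θ : ℕ → L.Term ℕ) :
      IsInstance Φ (.subst θ) [⟨Γ, Δ⟩] ⟨Γ.image (·.subst θ), Δ.image (·.subst θ)⟩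
  | negL (Γ Δ : Finset (Fml L I)) (φ : Fml L I) :
      IsInstance Φ .negL [⟨Γ, insert φ Δ⟩] ⟨insert (.neg φ) Γ, Δ⟩
  | negR (Γ Δ : Finset (Fml L I)) (φ : Fml L I) :
      IsInstance Φ .negR [⟨insert φ Γ, Δ⟩] ⟨Γ, insert (.neg φ) Δ⟩
  | andL (Γ Δ : Finset (Fml L I)) (φ ψ : Fml L I) :
      IsInstance Φ .andL [⟨insert φ (insert ψ Γ), Δ⟩] ⟨insert (.and φ ψ) Γ, Δ⟩
  | andR (Γ Δ : Finset (Fml L I)) (φ ψ : Fml L I) :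
      IsInstance Φ .andR [⟨Γ, insert φ Δ⟩, ⟨Γ, insert ψ Δ⟩] ⟨Γ, insert (.and φ ψ) Δ⟩
  | orL (Γ Δ : Finset (Fml L I)) (φ ψ : Fml L I) :
      IsInstance Φ .orL [⟨insert φ Γ, Δ⟩, ⟨insert ψ Γ, Δ⟩] ⟨insert (.or φ ψ) Γ, Δ⟩
  | orR (Γ Δ : Finset (Fml L I)) (φ ψ : Fml L I) :
      IsInstance Φ .orR [⟨Γ, insert φ (insert ψ Δ)⟩] ⟨Γ, insert (.or φ ψ) Δ⟩
  | impL (Γ Δ : Finset (Fml L I)) (φ ψ : Fml L I) :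
      IsInstance Φ .impL [⟨Γ, insert φ Δ⟩, ⟨insert ψ Γ, Δ⟩] ⟨insert (.imp φ ψ) Γ, Δ⟩
  | impR (Γ Δ : Finset (Fml L I)) (φ ψ : Fml L I) :
      IsInstance Φ .impR [⟨insert φ Γ, insert ψ Δ⟩] ⟨Γ, insert (.imp φ ψ) Δ⟩
  | allL (Γ Δ : Finset (Fml L I)) (φ : Fml L I) (t : L.Term ℕ) :
      IsInstance Φ .allL [⟨insert (φ.inst t) Γ, Δ⟩] ⟨insert (.all φ) Γ, Δ⟩
  | allR (Γ Δ : Finset (Fml L I)) (φ : Fml L I) (x : ℕ)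
      (hx : ∀ ψ ∈ insert (.all φ) (Γ ∪ Δ), x ∉ ψ.fv) :
      IsInstance Φ .allR [⟨Γ, insert (φ.inst (.var x)) Δ⟩] ⟨Γ, insert (.all φ) Δ⟩
  | exL (Γ Δ : Finset (Fml L I)) (φ : Fml L I) (x : ℕ)
      (hx : ∀ ψ ∈ insert (.ex φ) (Γ ∪ Δ), x ∉ ψ.fv) :
      IsInstance Φ .exL [⟨insert (φ.inst (.var x)) Γ, Δ⟩] ⟨insert (.ex φ) Γ, Δ⟩
  | exR (Γ Δ : Finset (Fml L I)) (φ : Fml L I) (t : L.Term ℕ) :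
      IsInstance Φ .exR [⟨Γ, insert (φ.inst t) Δ⟩] ⟨Γ, insert (.ex φ) Δ⟩
  | eqL (Γ Δ : Finset (Fml L I)) (t u : L.Term ℕ) (x y : ℕ) (hxy : x ≠ y) :
      IsInstance Φ (.eqL t u)
        [⟨Γ.image (·.subst (subst₂ x u y t)), Δ.image (·.subst (subst₂ x u y t))⟩]
        ⟨insert (.eq t u) (Γ.image (·.subst (subst₂ x t y u))),
          Δ.image (·.subst (subst₂ x t y u))⟩
  | eqR (Γ Δ : Finset (Fml L I)) (t : L.Term ℕ) :
      IsInstance Φ .eqR [] ⟨Γ, insert (.eq t t) Δ⟩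
  | indR (Γ Δ : Finset (Fml L I)) {n : ℕ} (P : I n) (p : Production L I n) (hp : p ∈ Φ n P)
      (σ : Fin p.vars → L.Term ℕ) :
      IsInstance Φ (.indR P) (p.hyps.map fun a => ⟨Γ, insert (a.inst σ) Δ⟩)
        ⟨Γ, insert (.ind P fun i => (p.args i).subst σ) Δ⟩
  | case (Γ Δ : Finset (Fml L I)) {n : ℕ} (P : I n) (us : Fin n → L.Term ℕ)
      (ys : ∀ p : Production L I n, Fin p.vars → ℕ)
      (hinj : ∀ p ∈ Φ n P, Function.Injective (ys p))
      (hfresh : ∀ p ∈ Φ n P, ∀ j, ∀ φ ∈ insert (.ind P us) (Γ ∪ Δ), ys p j ∉ φ.fv) :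
      IsInstance Φ (.case P us ys)
        ((Φ n P).map fun p => ⟨Γ ∪ p.caseHyps us (ys p), Δ⟩)
        ⟨insert (.ind P us) Γ, Δ⟩

/-! ### Derivation trees, paths and traces -/

/-- The label of a node of a derivation tree: a sequent, with `some r` if the node is the conclusion
of the rule `r` and `none` if it is a bud. -/
abbrev Label (L : FirstOrder.Language.{u, v}) (I : ℕ → Type w) := Sequent L I × Option (Rule L I)

/-- `D` is a (possibly infinite, nonempty) derivation tree. Nodes are finite sequences of natural
numbers, and the children of `σ` are the `σ ++ [n]` in the domain of `D`. -/
structure IsDerivationTree (Φ : DefSet L I) (D : List ℕ → Option (Label L I)) : Prop where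
  root : D [] ≠ none
  prefix_closed : ∀ σ n, D (σ ++ [n]) ≠ none → D σ ≠ none
  bud : ∀ σ S, D σ = some (S, none) → ∀ n, D (σ ++ [n]) = none
  inner : ∀ σ S r, D σ = some (S, some r) → ∃ prems : List (Sequent L I),
    IsInstance Φ r prems S ∧ ∀ n, (D (σ ++ [n])).map Prod.fst = prems[n]?

/-- `τ` is the principal formula of an application `r` of a case rule and `τ'` is one of
its case-descendants in the assumption number `k` of that application. -/
def IsProgress (Φ : DefSet L I) (r : Rule L I) (k : ℕ) (τ τ' : Fml L I) : Prop :=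
  match r with
  | .case (n := n) P us ys => τ = .ind P us ∧ ∃ p, (Φ n P)[k]? = some p ∧
      ∃ a ∈ p.hyps, τ' = a.inst (fun j => .var (ys p j)) ∧ τ'.IsInd
  | _ => False

/-- A trace may go from the formula `τ` in the conclusion of an application of the rule `r` to the
formula `τ'` in the assumption number `k` of that application. -/
def TraceStep (Φ : DefSet L I) (r : Rule L I) (k : ℕ) (τ τ' : Fml L I) : Prop :=
  match r with
  | .subst θ => τ = τ'.subst θ
  | .eqL t u => ∃ (φ : Fml L I) (x y : ℕ), x ≠ y ∧
      τ = φ.subst (subst₂ x t y u) ∧ τ' = φ.subst (subst₂ x u y t)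
  | .case P us ys => IsProgress Φ (.case P us ys) k τ τ' ∨ τ' = τ
  | _ => τ' = τ

/-- The nodes `σ 0, σ 1, …` form an infinite path in `D`; the path goes from `σ i` to its child
number `d i`. -/
def IsInfPath (D : List ℕ → Option (Label L I)) (σ : ℕ → List ℕ) (d : ℕ → ℕ) : Prop :=
  ∀ i, D (σ i) ≠ none ∧ σ (i + 1) = σ i ++ [d i]

/-- `τ` is a trace following the infinite path `σ`. -/
def IsTrace (Φ : DefSet L I) (D : List ℕ → Option (Label L I)) (σ : ℕ → List ℕ) (d : ℕ → ℕ)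
    (τ : ℕ → Fml L I) : Prop :=
  ∀ i, ∃ S r, D (σ i) = some (S, some r) ∧ τ i ∈ S.ant ∧ (τ i).IsInd ∧
    TraceStep Φ r (d i) (τ i) (τ (i + 1))

/-- The formula number `i` is a progress point of the trace `τ`. -/
def IsProgressPoint (Φ : DefSet L I) (D : List ℕ → Option (Label L I)) (σ : ℕ → List ℕ)
    (d : ℕ → ℕ) (τ : ℕ → Fml L I) (i : ℕ) : Prop :=
  ∃ S r, D (σ i) = some (S, some r) ∧ IsProgress Φ r (d i) (τ i) (τ (i + 1))

/-- The global trace condition: along some tail of every infinite path there is a trace with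
infinitely many progress points. -/
def GlobalTraceCondition (Φ : DefSet L I) (D : List ℕ → Option (Label L I)) : Prop :=
  ∀ σ d, IsInfPath D σ d → ∃ (k : ℕ) (τ : ℕ → Fml L I),
    IsTrace Φ D (fun i => σ (k + i)) (fun i => d (k + i)) τ ∧
    ∀ m, ∃ i ≥ m, IsProgressPoint Φ D (fun i => σ (k + i)) (fun i => d (k + i)) τ i

/-! ### Cyclic proofs -/

/-- A CLKID pre-proof: a finite derivation tree and a companion for each of its buds, that is,
an inner node with the same sequent. -/
structure PreProof (Φ : DefSet L I) where
  tree : List ℕ → Option (Label L I)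
  isDerivationTree : IsDerivationTree Φ tree
  finite_dom : {σ | tree σ ≠ none}.Finite
  companion : List ℕ → List ℕ
  companion_spec : ∀ σ S, tree σ = some (S, none) →
    ∃ r, tree (companion σ) = some (S, some r)

namespace PreProof

variable {Φ : DefSet L I}

/-- Move from the inner node `ν` to its child number `n`, and on to the companion if that
child is a bud. -/
def move (Q : PreProof Φ) (ν : List ℕ) (n : ℕ) : Option (List ℕ) :=
  match Q.tree (ν ++ [n]) with
  | none => none
  | some (_, some _) => some (ν ++ [n])
  | some (_, none) => some (Q.companion (ν ++ [n]))

/-- The inner node of the finite tree which the node `σ` of the tree-unfolding is a copy of. -/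
def locate (Q : PreProof Φ) (σ : List ℕ) : Option (List ℕ) := σ.foldlM Q.move []

/-- The tree-unfolding. -/
def unfolding (Q : PreProof Φ) (σ : List ℕ) : Option (Label L I) := (Q.locate σ).bind Q.tree

/-- The root is an inner node. -/
theorem root_inner (Q : PreProof Φ) : ∃ S r, Q.tree [] = some (S, some r) := by
  rcases h : Q.tree [] with _ | ⟨S, _ | r⟩
  · exact absurd h Q.isDerivationTree.root
  · exfalso
    obtain ⟨r, hr⟩ := Q.companion_spec _ _ h
    have key : ∀ σ : List ℕ, Q.tree σ ≠ none → σ = [] := by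
      intro σ
      induction σ using List.reverseRecOn with
      | nil => simp
      | append_singleton σ n ih =>
        intro hn
        have := ih (Q.isDerivationTree.prefix_closed σ n hn)
        subst this
        exact absurd (Q.isDerivationTree.bud [] S h n) hn
    rw [key (Q.companion []) (by rw [hr]; simp), h] at hr
    simp at hr
  · exact ⟨S, r, rfl⟩

theorem locate_inner (Q : PreProof Φ) (σ : List ℕ) :
    ∀ S r, Q.tree σ = some (S, some r) → Q.locate σ = some σ := by
  induction σ using List.reverseRecOn with
  | nil => intro S r _; rfl
  | append_singleton σ n ih =>
    intro S r h
    have hσ := Q.isDerivationTree.prefix_closed σ n (by rw [h]; simp)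
    rcases h' : Q.tree σ with _ | ⟨S', _ | r'⟩
    · exact absurd h' hσ
    · rw [Q.isDerivationTree.bud σ S' h' n] at h
      simp at h
    · have := ih S' r' h'
      unfold locate at this ⊢
      rw [List.foldlM_append, this]
      simp [move, h]

/-- On inner nodes of the finite tree the tree-unfolding is the tree itself. -/
theorem unfolding_inner (Q : PreProof Φ) (σ : List ℕ) (S : Sequent L I) (r : Rule L I)
    (h : Q.tree σ = some (S, some r)) : Q.unfolding σ = Q.tree σ := by
  simp [unfolding, Q.locate_inner σ S r h]

/-- Above a bud the tree-unfolding continues as above the companion of the bud. -/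
theorem unfolding_bud (Q : PreProof Φ) (σ₁ σ₂ : List ℕ) (S : Sequent L I)
    (h : Q.tree σ₁ = some (S, none)) :
    Q.unfolding (σ₁ ++ σ₂) = Q.unfolding (Q.companion σ₁ ++ σ₂) := by
  obtain ⟨r, hr⟩ := Q.companion_spec _ _ h
  have h2 := Q.locate_inner _ S r hr
  have h1 : Q.locate σ₁ = some (Q.companion σ₁) := by
    rcases List.eq_nil_or_concat' σ₁ with rfl | ⟨σ, n, rfl⟩
    · obtain ⟨S', r', h'⟩ := Q.root_inner
      rw [h'] at h
      simp at h
    · have hσ := Q.isDerivationTree.prefix_closed σ n (by rw [h]; simp)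
      rcases h' : Q.tree σ with _ | ⟨S', _ | r'⟩
      · exact absurd h' hσ
      · rw [Q.isDerivationTree.bud σ S' h' n] at h
        simp at h
      · have := Q.locate_inner σ S' r' h'
        unfold locate at this ⊢
        rw [List.foldlM_append, this]
        simp [move, h]
  unfold unfolding locate at *
  rw [List.foldlM_append, List.foldlM_append, h1, h2]

/-- A pre-proof is a proof if its tree-unfolding satisfies the global trace condition. -/
def IsProof (Q : PreProof Φ) : Prop := GlobalTraceCondition Φ Q.unfolding

/-- The sequent at the root is `S`. -/
def HasConclusion (Q : PreProof Φ) (S : Sequent L I) : Prop := ∃ r, Q.tree [] = some (S, r)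

/-- No node is the conclusion of the rule (Cut). -/
def CutFree (Q : PreProof Φ) : Prop := ∀ σ S, Q.tree σ ≠ some (S, some .cut)

end PreProof

/-- `S` is provable in CLKID. -/
def Provable (Φ : DefSet L I) (S : Sequent L I) : Prop :=
  ∃ Q : PreProof Φ, Q.HasConclusion S ∧ Q.IsProof

/-- `S` is cut-free provable in CLKID. -/
def CutFreeProvable (Φ : DefSet L I) (S : Sequent L I) : Prop :=
  ∃ Q : PreProof Φ, Q.HasConclusion S ∧ Q.IsProof ∧ Q.CutFree

/-- CLKID over the given language and inductive definitions has the cut-elimination property. -/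
def CutElimination (Φ : DefSet L I) : Prop := ∀ S, Provable Φ S → CutFreeProvable Φ S

/-! ### The predicates `TeF` and `FsT` -/

/-- The productions `TeF(e)` and `TeF(next x) / TeF(x)`. -/
def teFProductions (e : L.Constants) (next : L.Functions 1) (TeF : I 1) :
    List (Production L I 1) :=
  [{ vars := 0, hyps := [], args := fun _ => e.term },
    { vars := 1
      hyps := [.ind TeF fun _ => next.apply₁ (.var 0)]
      args := fun _ => .var 0 }]

/-- The productions `FsT(s)` and `FsT(x) / FsT(next x)`. -/
def fsTProductions (s : L.Constants) (next : L.Functions 1) (FsT : I 1) :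
    List (Production L I 1) :=
  [{ vars := 0, hyps := [], args := fun _ => s.term },
    { vars := 1
      hyps := [.ind FsT fun _ => .var 0]
      args := fun _ => next.apply₁ (.var 0) }]

/-- The sequent `TeF(s) ⊢ FsT(e)`. -/
def mainSequent (s e : L.Constants) (TeF FsT : I 1) : Sequent L I :=
  ⟨{.ind TeF fun _ => s.term}, {.ind FsT fun _ => e.term}⟩

end Proofs

/-- The function symbols of the minimal language: the constants `s` and `e` and the unary
function symbol `next`. -/
inductive MinFunc : ℕ → Type
  | s : MinFunc 0
  | e : MinFunc 0
  | next : MinFunc 1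

/-- The inductive predicate symbols of the minimal language, both unary. -/
inductive MinInd : ℕ → Type
  | TeF : MinInd 1
  | FsT : MinInd 1

/-- The minimal language, without ordinary predicate symbols. -/
def minLang : FirstOrder.Language.{0, 0} := ⟨MinFunc, fun _ => Empty⟩

/-- The inductive definitions of `TeF` and `FsT` over the minimal language. -/
def minDefs : DefSet minLang MinInd
  | _, .TeF => teFProductions (L := minLang) MinFunc.e MinFunc.next MinInd.TeF
  | _, .FsT => fsTProductions (L := minLang) MinFunc.s MinFunc.next MinInd.FsT

end CLKID

namespace CLKID

/-! ### A countermodel with an `ℕ`-chain starting at `s` and a `ℤ`-chain around `e` -/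

section Countermodel

variable {L : FirstOrder.Language.{u, v}} {I : ℕ → Type w}

/-! Provability comes from a cyclic induction. A cut introduces `FsT(s)`, and the goal generalises
to `TeF(x), FsT(x) ⊢ FsT(e)`. A case split on `TeF(x)` gives either `x = e` or `TeF(next x)`. In the
second case a cut supplies `FsT(next x)`, and the same sequent returns with `next x` for `x`. Each
round unfolds `TeF` once, so the trace condition holds.

Against cut-free proofs stands a structure with a chain `ℕ` starting at `s` and a chain `ℤ` around
`e`. There `FsT` is the `ℕ`-chain, and `TeF` is a fixed point of its productions that is not the
least one: all of the `ℕ`-chain, together with the points up to `e` on the `ℤ`-chain. Without cut,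
every refuted sequent that arises above the root has only equations and `TeF` on the left and only
`FsT` on the right, and a refutation passes from the conclusion of a rule to one of its assumptions.
This yields an infinite path of refuted sequents (`Refutes.exists_premise`).

Along a trace on this path the argument of `TeF` moves one step forward at each progress point. On
the `ℤ`-chain it must stop at `e`, but on the `ℕ`-chain it could run forever. This is prevented by
changing the valuation: a sequent has finitely many terms, so far points of the `ℕ`-chain can be
moved to the `ℤ`-chain without disturbing `next` on the terms in question
(`exists_bounded_refutation`). The move keeps equations and `TeF` true and `FsT` false. It may make
a true `FsT` false, which is why an antecedent with `FsT`, as produced by a cut, would break the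
argument.

A cyclic proof has finitely many sequents, so one bound `B` serves the whole unfolding. The
lexicographic `rank` then never increases along a trace and drops at each progress point, so no
trace progresses infinitely often (`not_isProof_of_refutes`). -/

/-- The successor on the two chains. -/
def chainSucc : ℕ ⊕ ℤ → ℕ ⊕ ℤ
  | .inl p => .inl (p + 1)
  | .inr z => .inr (z + 1)

open Classical in
/-- The value of a term in the countermodel: `s` starts the `ℕ`-chain, `next` is the successor, and
all other function symbols are constantly the point `0` of the `ℤ`-chain. -/
noncomputable def val {α : Type} (s : L.Constants) (next : L.Functions 1) (ρ : α → ℕ ⊕ ℤ) :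
    L.Term α → ℕ ⊕ ℤ
  | .var x => ρ x
  | .func (l := n) f ts =>
    if h : (⟨n, f⟩ : Σ n, L.Functions n) = ⟨1, next⟩ then
      chainSucc (val s next ρ (ts ⟨0, by cases h; exact Nat.one_pos⟩))
    else if (⟨n, f⟩ : Σ n, L.Functions n) = ⟨0, s⟩ then .inl 0 else .inr 0

/-- The nesting depth of function symbols. -/
def termDepth : L.Term ℕ → ℕ
  | .var _ => 0
  | .func _ ts => (Finset.univ.sup fun i => termDepth (ts i)) + 1

variable {s e : L.Constants} {next : L.Functions 1}

theorem val_s {α : Type} (ρ : α → ℕ ⊕ ℤ) : val s next ρ s.term = .inl 0 := by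
  have : (⟨0, s⟩ : Σ n, L.Functions n) ≠ ⟨1, next⟩ := by
    intro h; cases congrArg Sigma.fst h
  simp [FirstOrder.Language.Constants.term, val, this]

theorem val_e {α : Type} (hse : s ≠ e) (ρ : α → ℕ ⊕ ℤ) : val s next ρ e.term = .inr 0 := by
  have h1 : (⟨0, e⟩ : Σ n, L.Functions n) ≠ ⟨1, next⟩ := by
    intro h; cases congrArg Sigma.fst h
  have h2 : (⟨0, e⟩ : Σ n, L.Functions n) ≠ ⟨0, s⟩ := by
    intro h; cases h; exact hse rfl
  simp [FirstOrder.Language.Constants.term, val, h1, h2]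

theorem val_next {α : Type} (ρ : α → ℕ ⊕ ℤ) (t : L.Term α) :
    val s next ρ (next.apply₁ t) = chainSucc (val s next ρ t) := by
  simp [FirstOrder.Language.Functions.apply₁, val]

theorem val_subst {α β : Type} (ρ : β → ℕ ⊕ ℤ) (θ : α → L.Term β) (t : L.Term α) :
    val s next ρ (t.subst θ) = val s next (fun x => val s next ρ (θ x)) t := by
  induction t with
  | var x => rfl
  | func f ts ih => simp only [FirstOrder.Language.Term.subst, val, ih]

theorem val_congr {ρ ρ' : ℕ → ℕ ⊕ ℤ} (t : L.Term ℕ)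
    (h : ∀ x ∈ t.varFinset, ρ x = ρ' x) : val s next ρ t = val s next ρ' t := by
  induction t with
  | var x => exact h x (by simp [FirstOrder.Language.Term.varFinset])
  | func f ts ih =>
    have : ∀ i, val s next ρ (ts i) = val s next ρ' (ts i) := fun i =>
      ih i fun x hx => h x (by
        simp only [FirstOrder.Language.Term.varFinset, Finset.mem_biUnion]
        exact ⟨i, Finset.mem_univ i, hx⟩)
    simp only [val, this]

/-! ### Moving distant points of the `ℕ`-chain to the `ℤ`-chain -/

/-- Move the points of the `ℕ`-chain from `b` on to the `ℤ`-chain. -/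
def relocate (b M : ℕ) : ℕ ⊕ ℤ → ℕ ⊕ ℤ
  | .inl p => if p < b then .inl p else .inr (p - M)
  | .inr z => .inr z

/-- If no variable takes a value in the interval from `a` to `a + D`, then fewer than `D + 1`
applications of `next` cannot carry a value from below the interval past its end, so relocation at
`a + D` never separates a point from its successor. The second conjunct is the invariant that drives
the induction. The condition `1 ≤ a` keeps the value `0` of `s` below the interval. -/
theorem val_relocate {ρ : ℕ → ℕ ⊕ ℤ} {a D M : ℕ} (ha : 1 ≤ a) (t : L.Term ℕ)
    (hD : termDepth t ≤ D) (hgap : ∀ x ∈ t.varFinset, ∀ p, ρ x = .inl p → p < a ∨ a + D ≤ p) :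
    val s next (fun x => relocate (a + D) M (ρ x)) t = relocate (a + D) M (val s next ρ t) ∧
      ∀ p, val s next ρ t = .inl p → p < a + termDepth t ∨ a + D ≤ p := by
  induction t with
  | var x =>
    refine ⟨rfl, fun p hp => ?_⟩
    simpa [termDepth] using hgap x (by simp [FirstOrder.Language.Term.varFinset]) p hp
  | func f ts ih =>
    have hd : ∀ i, termDepth (ts i) + 1 ≤ termDepth (.func f ts) := fun i =>
      Nat.succ_le_succ (Finset.le_sup (f := fun i => termDepth (ts i)) (Finset.mem_univ i))
    have ih' := fun i => ih i ((Nat.le_succ _).trans ((hd i).trans hD)) fun x hx => hgap x (by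
      simp only [FirstOrder.Language.Term.varFinset, Finset.mem_biUnion]
      exact ⟨i, Finset.mem_univ i, hx⟩)
    rw [val, val]
    split_ifs with h1 h2
    · obtain ⟨e1, e2⟩ := ih' ⟨0, by cases h1; exact Nat.one_pos⟩
      have hd' := hd ⟨0, by cases h1; exact Nat.one_pos⟩
      rw [e1]
      cases hv : val s next ρ (ts ⟨0, by cases h1; exact Nat.one_pos⟩) with
      | inl q =>
        have := e2 q hv
        refine ⟨?_, fun p hp => ?_⟩
        · simp only [relocate, chainSucc]
          rcases this with h | h
          · rw [if_pos (by omega), if_pos (by omega)]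
          · rw [if_neg (by omega), if_neg (by omega)]
            simp only [Sum.inr.injEq]
            push_cast
            ring
        · simp only [chainSucc, Sum.inl.injEq] at hp
          omega
      | inr z => simp [relocate, chainSucc]
    · refine ⟨by simp only [relocate]; rw [if_pos (by omega)], fun p hp => ?_⟩
      simp only [Sum.inl.injEq] at hp
      omega
    · simp [relocate]

/-- Pigeonhole: of the `X.card + 1` consecutive intervals of length `D` starting at `1`, some
interval misses `X`. -/
theorem exists_gap (X : Finset ℕ) (D : ℕ) :
    ∃ a, 1 ≤ a ∧ a ≤ 1 + X.card * D ∧ ∀ p ∈ X, p < a ∨ a + D ≤ p := by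
  by_contra! h
  have key : Finset.range (X.card + 1) ⊆ X.image fun p => (p - 1) / D := by
    intro i hi
    rw [Finset.mem_range] at hi
    obtain ⟨p, hp, h1, h2⟩ := h (1 + i * D) (by omega)
      (by have := Nat.mul_le_mul_right D (Nat.lt_succ_iff.mp hi); omega)
    refine Finset.mem_image.mpr ⟨p, hp, ?_⟩
    rw [Nat.div_eq_iff (by omega)]
    constructor <;> omega
  have := (Finset.card_le_card key).trans Finset.card_image_le
  simp at this

/-! ### Refuted sequents -/

/-- The points at which `TeF` holds. -/
def ReachesE : ℕ ⊕ ℤ → Prop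
  | .inl _ => True
  | .inr z => z ≤ 0

/-- `φ` is an equation or a formula `TeF(t)`, and it is true. -/
inductive TrueAnt (s : L.Constants) (next : L.Functions 1) (TeF : I 1) (ρ : ℕ → ℕ ⊕ ℤ) :
    Fml L I → Prop
  | eq (t u : L.Term ℕ) (h : val s next ρ t = val s next ρ u) : TrueAnt s next TeF ρ (.eq t u)
  | ind (ts : Fin 1 → L.Term ℕ) (h : ReachesE (val s next ρ (ts 0))) :
      TrueAnt s next TeF ρ (.ind TeF ts)

/-- `φ` is a formula `FsT(t)`, and it is false. -/
inductive FalseSuc (s : L.Constants) (next : L.Functions 1) (FsT : I 1) (ρ : ℕ → ℕ ⊕ ℤ) :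
    Fml L I → Prop
  | ind (ts : Fin 1 → L.Term ℕ) (z : ℤ) (h : val s next ρ (ts 0) = .inr z) :
      FalseSuc s next FsT ρ (.ind FsT ts)

/-- `S` consists of equations and formulas `TeF(t)` on the left and `FsT(t)` on the right, and
the countermodel refutes it. -/
structure Refutes (s : L.Constants) (next : L.Functions 1) (TeF FsT : I 1) (ρ : ℕ → ℕ ⊕ ℤ)
    (S : Sequent L I) : Prop where
  ant : ∀ φ ∈ S.ant, TrueAnt s next TeF ρ φ
  suc : ∀ φ ∈ S.suc, FalseSuc s next FsT ρ φ

variable {TeF FsT : I 1}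

/-! ### Truth and falsity under substitution and change of valuation -/

theorem trueAnt_subst {ρ : ℕ → ℕ ⊕ ℤ} {θ : ℕ → L.Term ℕ} {φ : Fml L I} :
    TrueAnt s next TeF ρ (φ.subst θ) ↔ TrueAnt s next TeF (fun x => val s next ρ (θ x)) φ := by
  constructor
  · intro h
    cases φ <;> simp only [Fml.subst] at h <;> cases h <;> rename_i h
    · exact .eq _ _ (by simpa only [val_subst] using h)
    · exact .ind _ (by simpa only [val_subst] using h)
  · intro h
    cases h <;> rename_i h
    · exact .eq _ _ (by simpa only [val_subst] using h)
    · exact .ind _ (by simpa only [val_subst] using h)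

theorem falseSuc_subst {ρ : ℕ → ℕ ⊕ ℤ} {θ : ℕ → L.Term ℕ} {φ : Fml L I} :
    FalseSuc s next FsT ρ (φ.subst θ) ↔ FalseSuc s next FsT (fun x => val s next ρ (θ x)) φ := by
  constructor
  · intro h
    cases φ <;> simp only [Fml.subst] at h <;> rcases h with ⟨_, z, h⟩
    exact .ind _ z (by simpa only [val_subst] using h)
  · intro h
    cases h
    rename_i z h
    exact .ind _ z (by simpa only [val_subst] using h)

theorem TrueAnt.congr {ρ ρ' : ℕ → ℕ ⊕ ℤ} {φ : Fml L I} (h : TrueAnt s next TeF ρ φ)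
    (hρ : ∀ x ∈ φ.fv, ρ x = ρ' x) : TrueAnt s next TeF ρ' φ := by
  cases h with
  | eq t u h =>
    exact .eq _ _ (by rwa [← val_congr t fun x hx => hρ x (.inl hx),
      ← val_congr u fun x hx => hρ x (.inr hx)])
  | ind ts h => exact .ind _ (by rwa [← val_congr (ts 0) fun x hx => hρ x ⟨0, hx⟩])

theorem FalseSuc.congr {ρ ρ' : ℕ → ℕ ⊕ ℤ} {φ : Fml L I} (h : FalseSuc s next FsT ρ φ)
    (hρ : ∀ x ∈ φ.fv, ρ x = ρ' x) : FalseSuc s next FsT ρ' φ := by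
  cases h with
  | ind ts z h => exact .ind _ z (by rwa [← val_congr (ts 0) fun x hx => hρ x ⟨0, hx⟩])

/-- The value of the first argument of a formula `P(t₁, …, tₙ)` with an inductive predicate. -/
noncomputable def argVal (s : L.Constants) (next : L.Functions 1) (ρ : ℕ → ℕ ⊕ ℤ) :
    Fml L I → ℕ ⊕ ℤ
  | .ind (n := n) _ ts => if h : 0 < n then val s next ρ (ts ⟨0, h⟩) else .inr 0
  | _ => .inr 0

theorem argVal_subst (ρ : ℕ → ℕ ⊕ ℤ) (θ : ℕ → L.Term ℕ) (φ : Fml L I) :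
    argVal s next ρ (φ.subst θ) = argVal s next (fun x => val s next ρ (θ x)) φ := by
  cases φ <;> simp only [Fml.subst, argVal, val_subst]

theorem argVal_congr {ρ ρ' : ℕ → ℕ ⊕ ℤ} (φ : Fml L I) (hρ : ∀ x ∈ φ.fv, ρ x = ρ' x) :
    argVal s next ρ φ = argVal s next ρ' φ := by
  cases φ <;> simp only [argVal]
  split_ifs with h
  · exact val_congr _ fun x hx => hρ x ⟨_, hx⟩
  · rfl

/-- For equations this rests on the default value `.inr 0` of `argVal`, which satisfies `ReachesE`.
-/
theorem TrueAnt.reachesE {ρ : ℕ → ℕ ⊕ ℤ} {φ : Fml L I} (h : TrueAnt s next TeF ρ φ) :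
    ReachesE (argVal s next ρ φ) := by
  cases h with
  | eq => simp [argVal, ReachesE]
  | ind ts h => simpa [argVal] using h

/-! ### Bounded refutations -/

/-- The terms occurring outside of quantifiers in an atomic formula. -/
def atomTerms : Fml L I → Set (L.Term ℕ)
  | .eq t u => {t, u}
  | .ind _ ts => Set.range ts
  | _ => ∅

theorem atomTerms_finite (φ : Fml L I) : (atomTerms φ).Finite := by
  cases φ <;> simp [atomTerms, Set.finite_range]

theorem exists_finset_atomTerms (S : Sequent L I) :
    ∃ T : Finset (L.Term ℕ), ∀ φ ∈ S.ant ∪ S.suc, ∀ t ∈ atomTerms φ, t ∈ T := by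
  classical
  refine ⟨(S.ant ∪ S.suc).biUnion fun φ => (atomTerms_finite φ).toFinset, fun φ hφ t ht => ?_⟩
  exact Finset.mem_biUnion.mpr ⟨φ, hφ, by simpa using ht⟩

/-- Every refuted sequent is refuted by a valuation which keeps the arguments of `TeF` on the
`ℕ`-chain below a bound depending on the sequent only; compared to the given valuation, arguments
are only moved from the `ℕ`-chain to the `ℤ`-chain. -/
theorem exists_bounded_refutation (S : Sequent L I) : ∃ B : ℕ, ∀ ρ, Refutes s next TeF FsT ρ S →
    ∃ ρ', Refutes s next TeF FsT ρ' S ∧ ∀ φ ∈ S.ant, φ.IsInd →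
      (∀ p, argVal s next ρ' φ = .inl p → p < B) ∧
      ∃ b M, argVal s next ρ' φ = relocate b M (argVal s next ρ φ) := by
  classical
  obtain ⟨T, hT⟩ := exists_finset_atomTerms S
  let V : Finset ℕ := T.biUnion fun t => t.varFinset
  let D : ℕ := T.sup termDepth
  -- The cut-off will be `a + D`, where the gap begins at some `a ≤ 1 + V.card * D`.
  refine ⟨1 + V.card * D + D, fun ρ hρ => ?_⟩
  let pos : ℕ ⊕ ℤ → ℕ := Sum.elim id fun _ => 0
  obtain ⟨a, ha1, ha2, hgap⟩ := exists_gap (V.image fun x => pos (ρ x)) D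
  have ha2' : a ≤ 1 + V.card * D :=
    ha2.trans (Nat.add_le_add_left (Nat.mul_le_mul_right D Finset.card_image_le) 1)
  -- Shifting by the largest value in use sends every moved point to some `z ≤ 0`, where `TeF`
  -- holds.
  let M : ℕ := T.sup fun t => pos (val s next ρ t)
  have hval : ∀ t ∈ T, val s next (fun x => relocate (a + D) M (ρ x)) t =
      relocate (a + D) M (val s next ρ t) := fun t ht =>
    (val_relocate ha1 t (Finset.le_sup ht) fun x hx p hp =>
      hgap p (Finset.mem_image.mpr ⟨x, Finset.mem_biUnion.mpr ⟨t, ht, hx⟩, by simp [pos, hp]⟩)).1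
  have hM : ∀ t ∈ T, ∀ p, val s next ρ t = .inl p → p ≤ M := fun t ht p hp => by
    have := Finset.le_sup (f := fun t => pos (val s next ρ t)) ht
    simpa [pos, hp, M] using this
  refine ⟨fun x => relocate (a + D) M (ρ x), ⟨fun φ hφ => ?_, fun φ hφ => ?_⟩, fun φ hφ _ => ?_⟩
  · have hT' := hT φ (Finset.mem_union_left _ hφ)
    cases hρ.ant φ hφ with
    | eq t u h =>
      exact .eq _ _ (by rw [hval t (hT' t (by simp [atomTerms])),
        hval u (hT' u (by simp [atomTerms])), h])
    | ind ts h =>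
      have ht := hT' (ts 0) (by simp [atomTerms])
      refine .ind _ ?_
      rw [hval _ ht]
      cases hv : val s next ρ (ts 0) with
      | inl p =>
        have := hM _ ht p hv
        simp only [relocate]
        split_ifs
        · trivial
        · simp only [ReachesE]; omega
      | inr z => rwa [hv] at h
  · have hT' := hT φ (Finset.mem_union_right _ hφ)
    cases hρ.suc φ hφ with
    | ind ts z h => exact .ind _ z (by rw [hval _ (hT' (ts 0) (by simp [atomTerms])), h]; rfl)
  · have hT' := hT φ (Finset.mem_union_left _ hφ)
    cases hρ.ant φ hφ with
    | eq t u h => rename_i h'; obtain ⟨_, _, _, h'⟩ := h'; cases h'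
    | ind ts h =>
      have hv := hval _ (hT' (ts 0) (by simp [atomTerms]))
      have hr : argVal s next (fun x => relocate (a + D) M (ρ x)) (.ind TeF ts : Fml L I) =
          relocate (a + D) M (argVal s next ρ (.ind TeF ts : Fml L I)) := by
        simpa [argVal] using hv
      refine ⟨fun p hp => ?_, a + D, M, hr⟩
      rw [hr] at hp
      cases hw : argVal s next ρ (.ind TeF ts : Fml L I) with
      | inl q =>
        rw [hw] at hp
        simp only [relocate] at hp
        split_ifs at hp
        cases hp
        omega
      | inr z => rw [hw] at hp; cases hp

end Countermodel

section Refutation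

variable {L : FirstOrder.Language.{u, v}} {I : ℕ → Type w} {Φ : DefSet L I}
variable {s e : L.Constants} {next : L.Functions 1} {TeF FsT : I 1}

/-! ### Refutations go up from the conclusion to an assumption -/

/-- What happens to the argument of `TeF` when a trace passes from `τ` to `τ'`. -/
structure TracksStep (Φ : DefSet L I) (s : L.Constants) (next : L.Functions 1) (r : Rule L I)
    (k : ℕ) (ρ ρ' : ℕ → ℕ ⊕ ℤ) (τ τ' : Fml L I) : Prop where
  progress : IsProgress Φ r k τ τ' → argVal s next ρ' τ' = chainSucc (argVal s next ρ τ)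
  stay : ¬ IsProgress Φ r k τ τ' → argVal s next ρ' τ' = argVal s next ρ τ

/-- The shape of a refuted sequent excludes the logical rules and the right rule for equality, and
`TeF ≠ FsT` excludes axioms. The remaining rules are sound in the structure because both predicates
are fixed points of their productions; leastness is not needed, since soundness of a case split is
local. Cut is excluded because its formula could have any shape. -/
theorem Refutes.exists_premise (hse : s ≠ e) (hTF : TeF ≠ FsT)
    (hT : Φ 1 TeF = teFProductions e next TeF) (hF : Φ 1 FsT = fsTProductions s next FsT)
    {r : Rule L I} {prems : List (Sequent L I)} {S : Sequent L I} (hr : IsInstance Φ r prems S)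
    (hcut : r ≠ .cut) {ρ : ℕ → ℕ ⊕ ℤ} (hρ : Refutes s next TeF FsT ρ S) :
    ∃ k S' ρ', prems[k]? = some S' ∧ Refutes s next TeF FsT ρ' S' ∧
      ∀ τ ∈ S.ant, ∀ τ', TraceStep Φ r k τ τ' → TracksStep Φ s next r k ρ ρ' τ τ' := by
  cases hr with
  | ax Γ Δ φ hΓ hΔ =>
    have h1 := hρ.ant φ hΓ
    have h2 := hρ.suc φ hΔ
    cases h1 <;> cases h2
    exact absurd rfl hTF
  | weak Γ' Δ' Γ Δ hΓ hΔ =>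
    refine ⟨0, _, ρ, rfl, ⟨fun φ h => hρ.ant φ (hΓ h), fun φ h => hρ.suc φ (hΔ h)⟩, ?_⟩
    rintro τ - τ' rfl
    exact ⟨False.elim, fun _ => rfl⟩
  | cut => exact absurd rfl hcut
  | subst Γ Δ θ =>
    refine ⟨0, _, fun x => val s next ρ (θ x), rfl,
      ⟨fun φ h => trueAnt_subst.mp (hρ.ant _ (Finset.mem_image_of_mem _ h)),
        fun φ h => falseSuc_subst.mp (hρ.suc _ (Finset.mem_image_of_mem _ h))⟩, ?_⟩
    rintro τ - τ' rfl
    exact ⟨False.elim, fun _ => (argVal_subst ρ θ τ').symm⟩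
  | negL Γ Δ φ => cases hρ.ant _ (Finset.mem_insert_self _ _)
  | negR Γ Δ φ => cases hρ.suc _ (Finset.mem_insert_self _ _)
  | andL Γ Δ φ ψ => cases hρ.ant _ (Finset.mem_insert_self _ _)
  | andR Γ Δ φ ψ => cases hρ.suc _ (Finset.mem_insert_self _ _)
  | orL Γ Δ φ ψ => cases hρ.ant _ (Finset.mem_insert_self _ _)
  | orR Γ Δ φ ψ => cases hρ.suc _ (Finset.mem_insert_self _ _)
  | impL Γ Δ φ ψ => cases hρ.ant _ (Finset.mem_insert_self _ _)
  | impR Γ Δ φ ψ => cases hρ.suc _ (Finset.mem_insert_self _ _)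
  | allL Γ Δ φ t => cases hρ.ant _ (Finset.mem_insert_self _ _)
  | allR Γ Δ φ x hx => cases hρ.suc _ (Finset.mem_insert_self _ _)
  | exL Γ Δ φ x hx => cases hρ.ant _ (Finset.mem_insert_self _ _)
  | exR Γ Δ φ t => cases hρ.suc _ (Finset.mem_insert_self _ _)
  | eqL Γ Δ t u x y hxy =>
    have htu : val s next ρ t = val s next ρ u := by
      cases hρ.ant _ (Finset.mem_insert_self _ _)
      assumption
    have hsub : ∀ x y : ℕ, (fun z => val s next ρ (subst₂ x t y u z)) =
        fun z => val s next ρ (subst₂ x u y t z) := by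
      intro x y
      funext z
      simp only [subst₂]
      split_ifs <;> simp [htu]
    refine ⟨0, _, ρ, rfl, ⟨fun φ h => ?_, fun φ h => ?_⟩, ?_⟩
    · obtain ⟨ψ, hψ, rfl⟩ := Finset.mem_image.mp h
      rw [trueAnt_subst, ← hsub, ← trueAnt_subst]
      exact hρ.ant _ (Finset.mem_insert_of_mem (Finset.mem_image_of_mem _ hψ))
    · obtain ⟨ψ, hψ, rfl⟩ := Finset.mem_image.mp h
      rw [falseSuc_subst, ← hsub, ← falseSuc_subst]
      exact hρ.suc _ (Finset.mem_image_of_mem _ hψ)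
    · rintro τ - τ' ⟨φ, x', y', -, rfl, rfl⟩
      exact ⟨False.elim, fun _ => by rw [argVal_subst, argVal_subst, hsub]⟩
  | eqR Γ Δ t => cases hρ.suc _ (Finset.mem_insert_self _ _)
  | @indR Γ Δ n P p hp σ =>
    have h := hρ.suc _ (Finset.mem_insert_self _ _)
    obtain rfl : n = 1 := by cases h; rfl
    obtain rfl : P = FsT := by cases h; rfl
    have hz : ∃ z, val s next ρ ((p.args 0).subst σ) = .inr z := by
      rcases h with ⟨_, z, h⟩
      exact ⟨z, h⟩
    obtain ⟨z, hz⟩ := hz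
    rw [hF] at hp
    simp only [fsTProductions, List.mem_cons, List.not_mem_nil, or_false] at hp
    rcases hp with rfl | rfl
    · simp [val_subst, val_s] at hz
    · refine ⟨0, _, ρ, rfl, ⟨hρ.ant, fun φ hφ => ?_⟩, ?_⟩
      · rcases Finset.mem_insert.mp hφ with rfl | hφ
        · rw [val_subst, val_next] at hz
          cases hv : val s next ρ (σ 0) with
          | inl q => simp [val, hv, chainSucc] at hz
          | inr z' => exact .ind _ z' hv
        · exact hρ.suc _ (Finset.mem_insert_of_mem hφ)
      · rintro τ - τ' rfl
        exact ⟨False.elim, fun _ => rfl⟩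
  | @case Γ Δ n P us ys hinj hfresh =>
    have h := hρ.ant _ (Finset.mem_insert_self _ _)
    obtain rfl : n = 1 := by cases h; rfl
    obtain rfl : P = TeF := by cases h; rfl
    have hu : ReachesE (val s next ρ (us 0)) := by
      cases h
      assumption
    by_cases h0 : val s next ρ (us 0) = .inr 0
    -- The argument equals `e`: take the base production, which has no assumptions and so no
    -- progress.
    · let p : Production L I 1 := ⟨0, [], fun _ => e.term⟩
      have hk : (Φ 1 P)[0]? = some p := by rw [hT]; rfl
      refine ⟨0, ⟨Γ ∪ p.caseHyps us (ys p), Δ⟩, ρ, by rw [List.getElem?_map, hk]; rfl,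
        ⟨fun φ hφ => ?_, hρ.suc⟩, ?_⟩
      · simp only [Production.caseHyps, p, List.map_nil, List.toFinset_nil, Finset.union_empty,
          Finset.mem_union, Finset.mem_image, Finset.mem_univ, true_and] at hφ
        rcases hφ with hφ | ⟨i, rfl⟩
        · exact hρ.ant _ (Finset.mem_insert_of_mem hφ)
        · refine .eq _ _ ?_
          rw [Subsingleton.elim i 0, h0, val_subst, val_e hse]
      · intro τ _ τ' hstep
        have hnp : ¬ IsProgress Φ (.case P us ys) 0 τ τ' := by
          rintro ⟨-, p, hp, a, ha, -⟩
          rw [hT] at hp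
          cases hp
          cases ha
        refine ⟨fun h => absurd h hnp, fun _ => ?_⟩
        rcases hstep with hstep | rfl
        · exact absurd hstep hnp
        · rfl
    -- The argument differs from `e`, so its successor still satisfies `ReachesE`. The fresh
    -- variable takes the value of the argument.
    · let p : Production L I 1 := ⟨1, [.ind P fun _ => next.apply₁ (.var 0)], fun _ => .var 0⟩
      have hp : p ∈ Φ 1 P := by rw [hT]; exact List.mem_cons_of_mem _ (List.mem_singleton.mpr rfl)
      have hk : (Φ 1 P)[1]? = some p := by rw [hT]; rfl
      let ρ' : ℕ → ℕ ⊕ ℤ := Function.update ρ (ys p 0) (val s next ρ (us 0))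
      have hρ' : ∀ φ ∈ insert (.ind P us) (Γ ∪ Δ), ∀ x ∈ φ.fv, ρ x = ρ' x := by
        intro φ hφ x hx
        refine (Function.update_of_ne ?_ _ _).symm
        rintro rfl
        exact hfresh p hp 0 φ hφ hx
      have hus : val s next ρ' (us 0) = val s next ρ (us 0) :=
        (val_congr _ fun x hx => hρ' _ (Finset.mem_insert_self _ _) x ⟨0, hx⟩).symm
      have hnx : val s next ρ' ((next.apply₁ (.var (0 : Fin 1))).subst fun j => .var (ys p j)) =
          chainSucc (val s next ρ (us 0)) := by
        have : ((next.apply₁ (.var (0 : Fin 1))).subst fun j => .var (ys p j)) =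
            next.apply₁ (.var (ys p 0)) := by
          simp only [FirstOrder.Language.Functions.apply₁, FirstOrder.Language.Term.subst]
          congr 1
          funext i
          rw [Subsingleton.elim i 0]
          rfl
        rw [this, val_next]
        simp [val, ρ']
      refine ⟨1, ⟨Γ ∪ p.caseHyps us (ys p), Δ⟩, ρ', by rw [List.getElem?_map, hk]; rfl,
        ⟨fun φ hφ => ?_, fun φ hφ => ?_⟩, ?_⟩
      · simp only [Production.caseHyps, p, Finset.mem_union, Finset.mem_image, Finset.mem_univ,
          true_and, List.map_cons, List.map_nil, List.mem_toFinset, List.mem_singleton] at hφ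
        rcases hφ with hφ | ⟨i, rfl⟩ | rfl
        · exact (hρ.ant _ (Finset.mem_insert_of_mem hφ)).congr
            (hρ' _ (Finset.mem_insert_of_mem (Finset.mem_union_left _ hφ)))
        · refine .eq _ _ ?_
          rw [Subsingleton.elim i 0, hus]
          exact (Function.update_self _ _ ρ).symm
        · refine .ind _ ?_
          refine Eq.mpr (congrArg ReachesE hnx) ?_
          cases hv : val s next ρ (us 0) with
          | inl q => trivial
          | inr z =>
            rw [hv] at hu h0
            simp only [ReachesE, chainSucc, Sum.inr.injEq] at hu h0 ⊢
            omega
      · exact (hρ.suc _ hφ).congr (hρ' _ (Finset.mem_insert_of_mem (Finset.mem_union_right _ hφ)))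
      · intro τ hτ τ' hstep
        refine ⟨?_, fun hnp => ?_⟩
        · rintro ⟨rfl, p', hp', a, ha, rfl, -⟩
          rw [hk] at hp'
          cases hp'
          obtain rfl := List.mem_singleton.mp ha
          simpa [argVal, Atom.inst] using hnx
        · rcases hstep with hstep | rfl
          · exact absurd hstep hnp
          · refine (argVal_congr _ (hρ' _ ?_)).symm
            rcases Finset.mem_insert.mp hτ with h | h
            · exact Finset.mem_insert.mpr (.inl h)
            · exact Finset.mem_insert_of_mem (Finset.mem_union_left _ h)

/-! ### The rank of a point decreases at progress points -/

/-- The points of the `ℕ`-chain are ranked above those of the `ℤ`-chain. -/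
def rank (B : ℕ) : ℕ ⊕ ℤ → ℕ ×ₗ ℕ
  | .inl p => toLex (1, B - p)
  | .inr z => toLex (0, (-z).toNat)

theorem rank_relocate_le (B b M : ℕ) (v : ℕ ⊕ ℤ) : rank B (relocate b M v) ≤ rank B v := by
  cases v with
  | inl p =>
    simp only [relocate]
    split_ifs
    · exact le_rfl
    · exact (Prod.Lex.toLex_lt_toLex.mpr (.inl Nat.one_pos)).le
  | inr z => exact le_rfl

/-- Each hypothesis keeps one truncated subtraction strict: `hB` on the `ℕ`-chain, `hE` on the
`ℤ`-chain. A change of chain lowers the first coordinate. -/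
theorem rank_relocate_lt {B b M : ℕ} {v : ℕ ⊕ ℤ}
    (hB : ∀ p, relocate b M (chainSucc v) = .inl p → p < B)
    (hE : ReachesE (relocate b M (chainSucc v))) :
    rank B (relocate b M (chainSucc v)) < rank B v := by
  cases v with
  | inl p =>
    simp only [relocate, chainSucc] at hB ⊢
    split_ifs at hB ⊢
    · refine Prod.Lex.toLex_lt_toLex.mpr (.inr ⟨rfl, ?_⟩)
      have := hB _ rfl
      dsimp only
      omega
    · exact Prod.Lex.toLex_lt_toLex.mpr (.inl Nat.one_pos)
  | inr z =>
    simp only [relocate, chainSucc, ReachesE] at hE ⊢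
    refine Prod.Lex.toLex_lt_toLex.mpr (.inr ⟨rfl, ?_⟩)
    dsimp only
    omega

theorem not_frequently_lt_of_antitone {α : Type*} [PartialOrder α] [WellFoundedLT α] {f : ℕ → α}
    (hf : Antitone f) (h : ∀ m, ∃ i ≥ m, f (i + 1) < f i) : False := by
  obtain ⟨n, hn⟩ := WellFoundedGT.monotone_chain_condition
    (⟨fun i => OrderDual.toDual (f i), fun i j hij => hf hij⟩ : ℕ →o αᵒᵈ)
  obtain ⟨i, hi, hlt⟩ := h n
  have h1 : f n = f i := hn i hi
  have h2 : f n = f (i + 1) := hn (i + 1) (by omega)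
  exact absurd (h1.symm.trans h2) hlt.ne'

/-! ### Paths of refuted sequents -/

/-- A child that is a bud is replaced by its companion, which has the same sequent and is inner; so
a path can always continue into any chosen assumption. -/
theorem PreProof.exists_unfolding_child (Q : PreProof Φ) {σ : List ℕ} {S : Sequent L I}
    {r : Rule L I} (h : Q.unfolding σ = some (S, some r)) :
    ∃ prems, IsInstance Φ r prems S ∧ ∀ n S', prems[n]? = some S' →
      ∃ r', Q.unfolding (σ ++ [n]) = some (S', some r') := by
  unfold unfolding at h
  obtain ⟨ν, hν, hS⟩ := Option.bind_eq_some_iff.mp h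
  obtain ⟨prems, hr, hn⟩ := Q.isDerivationTree.inner ν S r hS
  refine ⟨prems, hr, fun n S' hS' => ?_⟩
  have hloc : Q.unfolding (σ ++ [n]) = (Q.move ν n).bind Q.tree := by
    unfold unfolding locate at *
    rw [List.foldlM_append, hν]
    cases h : Q.move ν n <;> simp [h]
  have hc := hn n
  rw [hS', Option.map_eq_some_iff] at hc
  obtain ⟨⟨S'', _ | r'⟩, hc, rfl⟩ := hc
  · obtain ⟨r', hr'⟩ := Q.companion_spec _ _ hc
    exact ⟨r', by rw [hloc]; simp [move, hc, hr']⟩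
  · exact ⟨r', by rw [hloc]; simp [move, hc]⟩

theorem PreProof.exists_tree_of_unfolding (Q : PreProof Φ) {σ : List ℕ} {l : Label L I}
    (h : Q.unfolding σ = some l) : ∃ ν, Q.tree ν = some l := by
  obtain ⟨ν, -, hν⟩ := Option.bind_eq_some_iff.mp h
  exact ⟨ν, hν⟩

theorem PreProof.exists_bound (Q : PreProof Φ) (f : Sequent L I → ℕ) :
    ∃ B, ∀ ν S r, Q.tree ν = some (S, r) → f S ≤ B := by
  obtain ⟨B, hB⟩ := (Q.finite_dom.image fun ν => ((Q.tree ν).map fun l => f l.1).getD 0).bddAbove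
  refine ⟨B, fun ν S r h => hB ⟨ν, by simp [h], by simp [h]⟩⟩

/-- No cut-free proof ends in a sequent which the countermodel refutes. -/
theorem not_isProof_of_refutes (hse : s ≠ e) (hTF : TeF ≠ FsT)
    (hT : Φ 1 TeF = teFProductions e next TeF) (hF : Φ 1 FsT = fsTProductions s next FsT)
    (Q : PreProof Φ) (hQ : Q.CutFree) {S₀ : Sequent L I} (hS₀ : Q.HasConclusion S₀)
    {ρ₀ : ℕ → ℕ ⊕ ℤ} (hρ₀ : Refutes s next TeF FsT ρ₀ S₀) : ¬ Q.IsProof := by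
  choose bound hbound using exists_bounded_refutation (s := s) (next := next) (TeF := TeF)
    (FsT := FsT) (L := L) (I := I)
  -- The finiteness of the pre-proof enters here: one bound for all sequents of the unfolding.
  obtain ⟨B, hB⟩ := Q.exists_bound bound
  let State := {q : List ℕ × (ℕ → ℕ ⊕ ℤ) //
    ∃ S r, Q.unfolding q.1 = some (S, some r) ∧ Refutes s next TeF FsT q.2 S}
  have hstep : ∀ q : State, ∃ (k : ℕ) (q' : State), q'.1.1 = q.1.1 ++ [k] ∧
      ∀ S r S' r', Q.unfolding q.1.1 = some (S, some r) →
        Q.unfolding q'.1.1 = some (S', some r') →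
        ∀ τ ∈ S.ant, ∀ τ' ∈ S'.ant, τ'.IsInd → TraceStep Φ r k τ τ' →
          rank B (argVal s next q'.1.2 τ') ≤ rank B (argVal s next q.1.2 τ) ∧
          (IsProgress Φ r k τ τ' →
            rank B (argVal s next q'.1.2 τ') < rank B (argVal s next q.1.2 τ)) := by
    rintro ⟨⟨σ, ρ⟩, S, r, hS, hρ⟩
    obtain ⟨prems, hr, hprems⟩ := Q.exists_unfolding_child hS
    have hcut : r ≠ .cut := by
      rintro rfl
      obtain ⟨ν, hν⟩ := Q.exists_tree_of_unfolding hS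
      exact hQ ν S hν
    obtain ⟨k, S', ρ', hS', hρ', htr⟩ := hρ.exists_premise hse hTF hT hF hr hcut
    obtain ⟨r', hr'⟩ := hprems k S' hS'
    -- The valuation is bounded anew after every rule, as a case split may have pushed an argument
    -- past the bound.
    obtain ⟨ρ'', hρ'', hb⟩ := hbound S' ρ' hρ'
    refine ⟨k, ⟨(σ ++ [k], ρ''), S', r', hr', hρ''⟩, rfl, ?_⟩
    intro S₁ r₁ S₂ r₂ h₁ h₂ τ hτ τ' hτ' hind hts
    obtain ⟨rfl, rfl⟩ : S = S₁ ∧ r = r₁ := by simpa [hS] using h₁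
    obtain ⟨rfl, rfl⟩ : S' = S₂ ∧ r' = r₂ := by simpa [hr'] using h₂
    obtain ⟨hlt, b, M, hbM⟩ := hb τ' hτ' hind
    have hE := (hρ''.ant τ' hτ').reachesE
    have hlt' : ∀ p, argVal s next ρ'' τ' = .inl p → p < B := fun p hp => by
      obtain ⟨ν, hν⟩ := Q.exists_tree_of_unfolding hr'
      exact (hlt p hp).trans_le (hB ν S' _ hν)
    have ht := htr τ hτ τ' hts
    have key : IsProgress Φ r k τ τ' →
        rank B (argVal s next ρ'' τ') < rank B (argVal s next ρ τ) := by
      intro hp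
      rw [hbM, ht.progress hp] at hlt' hE ⊢
      exact rank_relocate_lt hlt' hE
    refine ⟨?_, key⟩
    by_cases hp : IsProgress Φ r k τ τ'
    · exact (key hp).le
    · show rank B (argVal s next ρ'' τ') ≤ rank B (argVal s next ρ τ)
      rw [hbM, ht.stay hp]
      exact rank_relocate_le _ _ _ _
  have h₀ : ∃ S r, Q.unfolding [] = some (S, some r) ∧ Refutes s next TeF FsT ρ₀ S := by
    obtain ⟨S, r, h⟩ := Q.root_inner
    obtain ⟨r', h'⟩ := hS₀
    obtain ⟨rfl, rfl⟩ : S = S₀ ∧ some r = r' := by simpa [h] using h'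
    exact ⟨S, r, (Q.unfolding_inner [] S r h).trans h, hρ₀⟩
  choose child succ hsucc htrace using hstep
  let path : ℕ → State := fun i => succ^[i] ⟨([], ρ₀), h₀⟩
  have hpath : ∀ i, path (i + 1) = succ (path i) := fun i => Function.iterate_succ_apply' _ _ _
  intro hproof
  obtain ⟨k, τ, hτ, hprog⟩ := hproof (fun i => (path i).1.1) (fun i => child (path i)) fun i => by
    obtain ⟨S, r, h, -⟩ := (path i).2
    exact ⟨by rw [h]; simp, by dsimp only; rw [hpath, hsucc]⟩
  have hmain : ∀ i, ∀ S r, Q.unfolding (path (k + i)).1.1 = some (S, some r) →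
      rank B (argVal s next (path (k + (i + 1))).1.2 (τ (i + 1))) ≤
        rank B (argVal s next (path (k + i)).1.2 (τ i)) ∧
      (IsProgress Φ r (child (path (k + i))) (τ i) (τ (i + 1)) →
        rank B (argVal s next (path (k + (i + 1))).1.2 (τ (i + 1))) <
          rank B (argVal s next (path (k + i)).1.2 (τ i))) := by
    intro i S r hS
    obtain ⟨S₁, r₁, h₁, hmem, -, hts⟩ := hτ i
    obtain ⟨S₂, r₂, h₂, hmem', hind', -⟩ := hτ (i + 1)
    dsimp only at h₁ h₂ hts
    obtain ⟨rfl, rfl⟩ : S = S₁ ∧ r = r₁ := by simpa [hS] using h₁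
    rw [← Nat.add_assoc, hpath] at h₂ ⊢
    exact htrace (path (k + i)) S r S₂ r₂ h₁ h₂ _ hmem _ hmem' hind' hts
  refine not_frequently_lt_of_antitone
    (f := fun i => rank B (argVal s next (path (k + i)).1.2 (τ i))) ?_ ?_
  · refine antitone_nat_of_succ_le fun i => ?_
    obtain ⟨S, r, h, -⟩ := hτ i
    exact (hmain i S r h).1
  · intro m
    obtain ⟨i, hi, S, r, h, hp⟩ := hprog m
    exact ⟨i, hi, (hmain i S r h).2 hp⟩

theorem not_cutFreeProvable_mainSequent (hse : s ≠ e) (hTF : TeF ≠ FsT)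
    (hT : Φ 1 TeF = teFProductions e next TeF) (hF : Φ 1 FsT = fsTProductions s next FsT) :
    ¬ CutFreeProvable Φ (mainSequent s e TeF FsT) := by
  rintro ⟨Q, hconc, hproof, hcf⟩
  -- The sequent is closed, so any valuation would do.
  refine not_isProof_of_refutes (ρ₀ := fun _ => .inr 0) hse hTF hT hF Q hcf hconc ⟨?_, ?_⟩ hproof
  · intro φ hφ
    obtain rfl := Finset.mem_singleton.mp hφ
    exact .ind _ (by rw [val_s]; trivial)
  · intro φ hφ
    obtain rfl := Finset.mem_singleton.mp hφ
    exact .ind _ 0 (val_e hse _)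

end Refutation

/-! ### A cyclic proof with cuts -/

section CyclicProof

variable {L : FirstOrder.Language.{u, v}} {I : ℕ → Type w} {Φ : DefSet L I}

/-- The atomic formula `P(t)`. -/
abbrev atom₁ (P : I 1) (t : L.Term ℕ) : Fml L I := .ind P fun _ => t

/-- The term `next y`, where `y` is the variable `1`. -/
def nextVar (next : L.Functions 1) : L.Term ℕ := next.apply₁ (.var 1)

/-- The variables put for those of a production in the case distinction. -/
def caseVars : ∀ p : Production L I 1, Fin p.vars → ℕ := fun _ j => j + 1

/-- The derivation tree with its only bud at `[1, 0, 1, 0, 1, 0, 0]`. -/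
noncomputable def cyclicTree (s e : L.Constants) (next : L.Functions 1) (TeF FsT : I 1) :
    List ℕ → Option (Label L I)
  | [] => some (mainSequent s e TeF FsT, some .cut)
  | [0] => some (⟨{atom₁ TeF s.term}, {atom₁ FsT s.term, atom₁ FsT e.term}⟩, some (.indR FsT))
  | [1] => some (⟨{atom₁ FsT s.term, atom₁ TeF s.term}, {atom₁ FsT e.term}⟩,
      some (.subst fun _ => s.term))
  | [1, 0] => some (⟨{atom₁ TeF (.var 0), atom₁ FsT (.var 0)}, {atom₁ FsT e.term}⟩,
      some (.case TeF (fun _ => .var 0) caseVars))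
  | [1, 0, 0] => some (⟨{.eq (.var 0) e.term, atom₁ FsT (.var 0)}, {atom₁ FsT e.term}⟩,
      some (.eqL (.var 0) e.term))
  | [1, 0, 0, 0] => some (⟨{atom₁ FsT e.term}, {atom₁ FsT e.term}⟩, some .ax)
  | [1, 0, 1] => some
      (⟨{.eq (.var 0) (.var 1), atom₁ FsT (.var 0), atom₁ TeF (nextVar next)}, {atom₁ FsT e.term}⟩,
        some (.eqL (.var 0) (.var 1)))
  | [1, 0, 1, 0] => some
      (⟨{atom₁ FsT (.var 1), atom₁ TeF (nextVar next)}, {atom₁ FsT e.term}⟩, some .cut)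
  | [1, 0, 1, 0, 0] => some
      (⟨{atom₁ FsT (.var 1), atom₁ TeF (nextVar next)},
        {atom₁ FsT (nextVar next), atom₁ FsT e.term}⟩, some (.indR FsT))
  | [1, 0, 1, 0, 0, 0] => some
      (⟨{atom₁ FsT (.var 1), atom₁ TeF (nextVar next)},
        {atom₁ FsT (.var 1), atom₁ FsT e.term}⟩, some .ax)
  | [1, 0, 1, 0, 1] => some
      (⟨{atom₁ FsT (nextVar next), atom₁ FsT (.var 1), atom₁ TeF (nextVar next)},
        {atom₁ FsT e.term}⟩, some .weak)
  | [1, 0, 1, 0, 1, 0] => some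
      (⟨{atom₁ TeF (nextVar next), atom₁ FsT (nextVar next)}, {atom₁ FsT e.term}⟩,
        some (.subst fun _ => nextVar next))
  | [1, 0, 1, 0, 1, 0, 0] =>
      some (⟨{atom₁ TeF (.var 0), atom₁ FsT (.var 0)}, {atom₁ FsT e.term}⟩, none)
  | _ => none

/-- The nodes of `cyclicTree`. -/
def cyclicNodes : List (List ℕ) :=
  [[], [0], [1], [1, 0], [1, 0, 0], [1, 0, 0, 0], [1, 0, 1], [1, 0, 1, 0], [1, 0, 1, 0, 0],
    [1, 0, 1, 0, 0, 0], [1, 0, 1, 0, 1], [1, 0, 1, 0, 1, 0], [1, 0, 1, 0, 1, 0, 0]]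

variable {s e : L.Constants} {next : L.Functions 1} {TeF FsT : I 1}

theorem mem_cyclicNodes {σ : List ℕ} :
    cyclicTree s e next TeF FsT σ ≠ none ↔ σ ∈ cyclicNodes := by
  constructor
  · intro h
    unfold cyclicTree at h
    split at h <;> first | exact absurd rfl h | simp [cyclicNodes]
  · intro h
    simp only [cyclicNodes, List.mem_cons, List.not_mem_nil, or_false] at h
    rcases h with rfl | rfl | rfl | rfl | rfl | rfl | rfl | rfl | rfl | rfl | rfl | rfl | rfl <;>
      simp [cyclicTree]

theorem constants_term_subst {α β : Type} (c : L.Constants) (θ : α → L.Term β) :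
    (c.term : L.Term α).subst θ = c.term := by
  simp only [FirstOrder.Language.Constants.term, FirstOrder.Language.Term.subst]
  congr 1
  exact Subsingleton.elim _ _

theorem apply₁_subst {α β : Type} (f : L.Functions 1) (t : L.Term α) (θ : α → L.Term β) :
    (f.apply₁ t).subst θ = f.apply₁ (t.subst θ) := by
  simp only [FirstOrder.Language.Functions.apply₁, FirstOrder.Language.Term.subst]
  congr 1
  funext i
  rw [Subsingleton.elim i 0]
  rfl

theorem constants_term_varFinset (c : L.Constants) : (c.term : L.Term ℕ).varFinset = ∅ := by
  simp [FirstOrder.Language.Constants.term, FirstOrder.Language.Term.varFinset]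

/-! ### Rule instances of the cyclic proof -/

theorem isInstance_case (hT : Φ 1 TeF = teFProductions e next TeF) :
    IsInstance Φ (.case TeF (fun _ => .var 0) caseVars)
      [⟨{.eq (.var 0) e.term, atom₁ FsT (.var 0)}, {atom₁ FsT e.term}⟩,
        ⟨{.eq (.var 0) (.var 1), atom₁ FsT (.var 0), atom₁ TeF (nextVar next)},
          {atom₁ FsT e.term}⟩]
      ⟨{atom₁ TeF (.var 0), atom₁ FsT (.var 0)}, {atom₁ FsT e.term}⟩ := by
  have h := IsInstance.case (Φ := Φ) {atom₁ FsT (.var 0)} {atom₁ FsT e.term} TeF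
    (fun _ => .var 0) caseVars
    (fun p _ i j h => Fin.ext (Nat.succ_injective h)) (by
      intro p _ j φ hφ
      simp only [Finset.mem_insert, Finset.mem_union, Finset.mem_singleton] at hφ
      rcases hφ with rfl | rfl | rfl <;>
        simp [Fml.fv, caseVars, constants_term_varFinset, FirstOrder.Language.Term.varFinset])
  convert h using 1
  rw [hT]
  simp only [teFProductions, List.map_cons, List.map_nil, List.cons.injEq, Sequent.mk.injEq,
    and_true, Production.caseHyps, Atom.inst, constants_term_subst, apply₁_subst,
    FirstOrder.Language.Term.subst]
  constructor
  · ext φ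
    simp [or_comm]
  · ext φ
    simp [caseVars, nextVar]

theorem isInstance_eqL_const :
    IsInstance Φ (.eqL (.var 0) e.term) [⟨{atom₁ FsT e.term}, {atom₁ FsT e.term}⟩]
      ⟨{.eq (.var 0) e.term, atom₁ FsT (.var 0)}, {atom₁ FsT e.term}⟩ := by
  have h := IsInstance.eqL (Φ := Φ) {atom₁ FsT (.var 0)} {atom₁ FsT e.term} (.var 0) e.term 0 1
    Nat.zero_ne_one
  simpa [Fml.subst, constants_term_subst, FirstOrder.Language.Term.subst, subst₂] using h

theorem isInstance_eqL_var :
    IsInstance Φ (.eqL (.var 0) (.var 1))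
      [⟨{atom₁ FsT (.var 1), atom₁ TeF (nextVar next)}, {atom₁ FsT e.term}⟩]
      ⟨{.eq (.var 0) (.var 1), atom₁ FsT (.var 0), atom₁ TeF (nextVar next)},
        {atom₁ FsT e.term}⟩ := by
  -- The second variable is the unused `2`: taking `1` would also rewrite the variable inside
  -- `nextVar next`.
  have h := IsInstance.eqL (Φ := Φ) {atom₁ FsT (.var 0), atom₁ TeF (nextVar next)}
    {atom₁ FsT e.term} (.var 0) (.var 1) 0 2 (by decide)
  simpa [Fml.subst, constants_term_subst, apply₁_subst, FirstOrder.Language.Term.subst, subst₂,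
    nextVar] using h

theorem isInstance_subst_atoms (t : L.Term ℕ) :
    IsInstance Φ (.subst fun _ => t)
      [⟨{atom₁ TeF (.var 0), atom₁ FsT (.var 0)}, {atom₁ FsT e.term}⟩]
      ⟨{atom₁ TeF t, atom₁ FsT t}, {atom₁ FsT e.term}⟩ := by
  have h := IsInstance.subst (Φ := Φ) {atom₁ TeF (.var 0), atom₁ FsT (.var 0)}
    {atom₁ FsT e.term} (fun _ => t)
  simpa [Fml.subst, constants_term_subst, FirstOrder.Language.Term.subst] using h

theorem isInstance_indR_start (hF : Φ 1 FsT = fsTProductions s next FsT)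
    (Γ Δ : Finset (Fml L I)) :
    IsInstance Φ (.indR FsT) [] ⟨Γ, insert (atom₁ FsT s.term) Δ⟩ := by
  have h := IsInstance.indR (Φ := Φ) Γ Δ FsT ⟨0, [], fun _ => s.term⟩
    (by rw [hF]; exact List.mem_cons_self) Fin.elim0
  simpa [constants_term_subst] using h

theorem isInstance_indR_next (hF : Φ 1 FsT = fsTProductions s next FsT)
    (Γ Δ : Finset (Fml L I)) :
    IsInstance Φ (.indR FsT) [⟨Γ, insert (atom₁ FsT (.var 1)) Δ⟩]
      ⟨Γ, insert (atom₁ FsT (nextVar next)) Δ⟩ := by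
  have h := IsInstance.indR (Φ := Φ) Γ Δ FsT
    ⟨1, [.ind FsT fun _ => .var 0], fun _ => next.apply₁ (.var 0)⟩
    (by rw [hF]; exact List.mem_cons_of_mem _ (List.mem_singleton.mpr rfl)) (fun _ => .var 1)
  simpa [apply₁_subst, nextVar, Atom.inst, FirstOrder.Language.Term.subst] using h

theorem cyclicTree_inner (hT : Φ 1 TeF = teFProductions e next TeF)
    (hF : Φ 1 FsT = fsTProductions s next FsT) (σ : List ℕ) (S : Sequent L I) (r : Rule L I)
    (h : cyclicTree s e next TeF FsT σ = some (S, some r)) :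
    ∃ prems : List (Sequent L I), IsInstance Φ r prems S ∧
      ∀ n, (cyclicTree s e next TeF FsT (σ ++ [n])).map Prod.fst = prems[n]? := by
  have h0 : cyclicTree s e next TeF FsT σ ≠ none := by rw [h]; simp
  rw [mem_cyclicNodes] at h0
  simp only [cyclicNodes, List.mem_cons, List.not_mem_nil, or_false] at h0
  rcases h0 with rfl | rfl | rfl | rfl | rfl | rfl | rfl | rfl | rfl | rfl | rfl | rfl | rfl <;>
    cases h
  · exact ⟨_, .cut _ _ (atom₁ FsT s.term), fun | 0 => rfl | 1 => rfl | _ + 2 => rfl⟩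
  · exact ⟨_, isInstance_indR_start hF _ _, fun | 0 => rfl | _ + 1 => rfl⟩
  · refine ⟨[⟨{atom₁ TeF (.var 0), atom₁ FsT (.var 0)}, {atom₁ FsT e.term}⟩], ?_,
      fun | 0 => rfl | _ + 1 => rfl⟩
    rw [Finset.pair_comm (atom₁ FsT s.term)]
    exact isInstance_subst_atoms _
  · exact ⟨_, isInstance_case hT, fun | 0 => rfl | 1 => rfl | _ + 2 => rfl⟩
  · exact ⟨_, isInstance_eqL_const, fun | 0 => rfl | _ + 1 => rfl⟩
  · exact ⟨_, .ax _ _ (atom₁ FsT e.term) (by simp) (by simp), fun | 0 => rfl | _ + 1 => rfl⟩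
  · exact ⟨_, isInstance_eqL_var, fun | 0 => rfl | _ + 1 => rfl⟩
  · exact ⟨_, .cut _ _ (atom₁ FsT (nextVar next)), fun | 0 => rfl | 1 => rfl | _ + 2 => rfl⟩
  · exact ⟨_, isInstance_indR_next hF _ _, fun | 0 => rfl | _ + 1 => rfl⟩
  · exact ⟨_, .ax _ _ (atom₁ FsT (.var 1)) (by simp) (by simp), fun | 0 => rfl | _ + 1 => rfl⟩
  · refine ⟨_, .weak {atom₁ TeF (nextVar next), atom₁ FsT (nextVar next)} _ _ _ ?_
      (Finset.Subset.refl _), fun | 0 => rfl | _ + 1 => rfl⟩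
    intro φ
    simp only [Finset.mem_insert, Finset.mem_singleton]
    tauto
  · exact ⟨_, isInstance_subst_atoms _, fun | 0 => rfl | _ + 1 => rfl⟩

theorem isDerivationTree_cyclicTree (hT : Φ 1 TeF = teFProductions e next TeF)
    (hF : Φ 1 FsT = fsTProductions s next FsT) :
    IsDerivationTree Φ (cyclicTree s e next TeF FsT) where
  root := by simp [cyclicTree]
  prefix_closed σ n h := by
    have key : ∀ μ ∈ cyclicNodes, μ.dropLast ∈ cyclicNodes := by decide
    rw [mem_cyclicNodes] at h ⊢
    simpa using key _ h
  bud σ S h n := by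
    unfold cyclicTree at h
    split at h <;> cases h
    rfl
  inner := cyclicTree_inner hT hF

/-- The cyclic proof of `TeF(s) ⊢ FsT(e)`. -/
noncomputable def cyclicProof (hT : Φ 1 TeF = teFProductions e next TeF)
    (hF : Φ 1 FsT = fsTProductions s next FsT) : PreProof Φ where
  tree := cyclicTree s e next TeF FsT
  isDerivationTree := isDerivationTree_cyclicTree hT hF
  finite_dom := (List.finite_toSet cyclicNodes).subset fun _ h => mem_cyclicNodes.mp h
  companion _ := [1, 0]
  companion_spec σ S h := by
    unfold cyclicTree at h
    split at h <;> cases h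
    exact ⟨_, rfl⟩

/-! ### Infinite paths and the trace of the cyclic proof -/

/-- The edges of the graph of the inner nodes of `cyclicProof`. -/
def cyclicEdges : List (List ℕ × ℕ × List ℕ) :=
  [([], 0, [0]), ([], 1, [1]), ([1], 0, [1, 0]), ([1, 0], 0, [1, 0, 0]),
    ([1, 0, 0], 0, [1, 0, 0, 0]), ([1, 0], 1, [1, 0, 1]), ([1, 0, 1], 0, [1, 0, 1, 0]),
    ([1, 0, 1, 0], 0, [1, 0, 1, 0, 0]), ([1, 0, 1, 0, 0], 0, [1, 0, 1, 0, 0, 0]),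
    ([1, 0, 1, 0], 1, [1, 0, 1, 0, 1]), ([1, 0, 1, 0, 1], 0, [1, 0, 1, 0, 1, 0]),
    ([1, 0, 1, 0, 1, 0], 0, [1, 0])]

theorem mem_cyclicEdges (hT : Φ 1 TeF = teFProductions e next TeF)
    (hF : Φ 1 FsT = fsTProductions s next FsT) {ν ν' : List ℕ} {d : ℕ}
    (h : (cyclicProof hT hF).move ν d = some ν') : (ν, d, ν') ∈ cyclicEdges := by
  have hne : cyclicTree s e next TeF FsT (ν ++ [d]) ≠ none := by
    intro h0
    have : (cyclicProof hT hF).tree (ν ++ [d]) = none := h0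
    simp [PreProof.move, this] at h
  rw [mem_cyclicNodes] at hne
  generalize hμ : ν ++ [d] = μ at hne
  obtain rfl : ν = μ.dropLast := by rw [← hμ, List.dropLast_concat]
  obtain rfl : d = μ.getLast?.getD 0 := by rw [← hμ, List.getLast?_concat]; rfl
  simp only [PreProof.move, hμ] at h
  simp only [cyclicNodes, List.mem_cons, List.not_mem_nil, or_false] at hne
  rcases hne with rfl | rfl | rfl | rfl | rfl | rfl | rfl | rfl | rfl | rfl | rfl | rfl | rfl
  · simp at hμ
  all_goals
    cases h
    simp [cyclicEdges, cyclicProof]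

/-- The formula in the trace at a node of the cycle. -/
def cyclicTrace (next : L.Functions 1) (TeF : I 1) : List ℕ → Fml L I
  | [1, 0] => atom₁ TeF (.var 0)
  | _ => atom₁ TeF (nextVar next)

/-- A bound for the number of steps from a node to the node `[1, 0]`. -/
def cyclicDist : List ℕ → ℕ
  | [] => 2
  | [1] => 1
  | [1, 0, 0] => 1
  | [1, 0, 1] => 4
  | [1, 0, 1, 0] => 3
  | [1, 0, 1, 0, 0] => 1
  | [1, 0, 1, 0, 1] => 2
  | [1, 0, 1, 0, 1, 0] => 1
  | _ => 0

/-- Every cycle of the graph passes through `[1, 0]`, because `cyclicDist` strictly decreases along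
each edge that starts elsewhere. -/
theorem exists_eq_of_cyclicEdges {ν : ℕ → List ℕ} {d : ℕ → ℕ}
    (h : ∀ i, (ν i, d i, ν (i + 1)) ∈ cyclicEdges) (i : ℕ) : ∃ j ≥ i, ν j = [1, 0] := by
  have key : ∀ E ∈ cyclicEdges, E.1 ≠ [1, 0] → cyclicDist E.2.2 < cyclicDist E.1 := by decide
  induction hn : cyclicDist (ν i) using Nat.strong_induction_on generalizing i with
  | _ n ih =>
    by_cases hi : ν i = [1, 0]
    · exact ⟨i, le_rfl, hi⟩
    · obtain ⟨j, hj, hj'⟩ := ih _ (hn ▸ key _ (h i) hi) (i + 1) rfl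
      exact ⟨j, by omega, hj'⟩

/-- The edges of the cycle. -/
def cycleEdges : List (List ℕ × ℕ × List ℕ) :=
  [([1, 0], 1, [1, 0, 1]), ([1, 0, 1], 0, [1, 0, 1, 0]), ([1, 0, 1, 0], 1, [1, 0, 1, 0, 1]),
    ([1, 0, 1, 0, 1], 0, [1, 0, 1, 0, 1, 0]), ([1, 0, 1, 0, 1, 0], 0, [1, 0])]

theorem mem_cycleEdges_of_cyclicEdges {ν : ℕ → List ℕ} {d : ℕ → ℕ}
    (h : ∀ i, (ν i, d i, ν (i + 1)) ∈ cyclicEdges) (h0 : ν 0 = [1, 0]) (i : ℕ) :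
    (ν i, d i, ν (i + 1)) ∈ cycleEdges := by
  -- The nodes of the branches that end in axioms or the base rule of `FsT`. They are closed under
  -- successors and omit `[1, 0]`, so an infinite path avoids them.
  let dead : List (List ℕ) :=
    [[0], [1, 0, 0], [1, 0, 0, 0], [1, 0, 1, 0, 0], [1, 0, 1, 0, 0, 0]]
  have hdead : ∀ E ∈ cyclicEdges, E.1 ∈ dead → E.2.2 ∈ dead := by decide
  have hlive : ∀ i, ν i ∉ dead := by
    intro i hi
    obtain ⟨j, hj, hj'⟩ := exists_eq_of_cyclicEdges h i
    have : ν j ∈ dead := by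
      clear hj'
      induction j, hj using Nat.le_induction with
      | base => exact hi
      | succ j _ ih => exact hdead _ (h j) ih
    rw [hj'] at this
    revert this
    decide
  have hcycle : ∀ E ∈ cyclicEdges, E.1 ∈ cycleEdges.map Prod.fst → E.2.2 ∉ dead →
      E ∈ cycleEdges ∧ E.2.2 ∈ cycleEdges.map Prod.fst := by decide
  have hmem : ∀ i, ν i ∈ cycleEdges.map Prod.fst := by
    intro i
    induction i with
    | zero => rw [h0]; decide
    | succ i ih => exact (hcycle _ (h i) ih (hlive _)).2
  exact (hcycle _ (h i) (hmem i) (hlive _)).1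

theorem isProof_cyclicProof (hT : Φ 1 TeF = teFProductions e next TeF)
    (hF : Φ 1 FsT = fsTProductions s next FsT) : (cyclicProof hT hF).IsProof := by
  intro σ d hσ
  have hloc : ∀ i, ∃ ν, (cyclicProof hT hF).locate (σ i) = some ν := fun i => by
    cases h : (cyclicProof hT hF).locate (σ i) with
    | none => exact absurd (by simp [PreProof.unfolding, h]) (hσ i).1
    | some ν => exact ⟨ν, rfl⟩
  choose ν hν using hloc
  -- A path of the unfolding projects to a walk in the finite graph; its trace can be read off
  -- there.
  have hedge : ∀ i, (ν i, d i, ν (i + 1)) ∈ cyclicEdges := fun i => by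
    refine mem_cyclicEdges hT hF ?_
    have h := hν (i + 1)
    have h' := hν i
    unfold PreProof.locate at h h'
    rw [(hσ i).2, List.foldlM_append, h'] at h
    simpa using h
  obtain ⟨k, -, hk⟩ := exists_eq_of_cyclicEdges hedge 0
  have hcyc : ∀ i, (ν (k + i), d (k + i), ν (k + i + 1)) ∈ cycleEdges :=
    mem_cycleEdges_of_cyclicEdges (ν := fun i => ν (k + i)) (d := fun i => d (k + i))
      (fun i => hedge (k + i)) hk
  have hunf : ∀ i, (cyclicProof hT hF).unfolding (σ i) = cyclicTree s e next TeF FsT (ν i) :=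
    fun i => by rw [PreProof.unfolding, hν]; rfl
  have hprog : IsProgress Φ (.case TeF (fun _ => .var 0) caseVars) 1 (atom₁ TeF (.var 0))
      (atom₁ TeF (nextVar next)) := by
    refine ⟨rfl, ⟨1, [.ind TeF fun _ => next.apply₁ (.var 0)], fun _ => .var 0⟩, by rw [hT]; rfl,
      _, List.mem_singleton.mpr rfl, ?_, _, _, _, rfl⟩
    simp only [Atom.inst, apply₁_subst]
    rfl
  refine ⟨k, fun i => cyclicTrace next TeF (ν (k + i)), fun i => ?_, fun m => ?_⟩
  · have hc := hcyc i
    dsimp only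
    rw [hunf, ← Nat.add_assoc]
    generalize ν (k + i + 1) = ν' at hc ⊢
    generalize ν (k + i) = ν₀ at hc ⊢
    generalize d (k + i) = d₀ at hc ⊢
    simp only [cycleEdges, List.mem_cons, Prod.mk.injEq, List.not_mem_nil, or_false] at hc
    rcases hc with ⟨rfl, rfl, rfl⟩ | ⟨rfl, rfl, rfl⟩ | ⟨rfl, rfl, rfl⟩ | ⟨rfl, rfl, rfl⟩ |
      ⟨rfl, rfl, rfl⟩
    · exact ⟨_, _, rfl, by simp [cyclicTrace], ⟨_, _, _, rfl⟩, .inl hprog⟩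
    -- The variables `2` and `3` do not occur in `TeF(next y)`, so both substitutions leave it
    -- unchanged.
    · refine ⟨_, _, rfl, by simp [cyclicTrace], ⟨_, _, _, rfl⟩,
        atom₁ TeF (nextVar next), 2, 3, by decide, ?_, ?_⟩ <;>
      simp [cyclicTrace, Fml.subst, nextVar, apply₁_subst, FirstOrder.Language.Term.subst, subst₂]
    · exact ⟨_, _, rfl, by simp [cyclicTrace], ⟨_, _, _, rfl⟩, rfl⟩
    · exact ⟨_, _, rfl, by simp [cyclicTrace], ⟨_, _, _, rfl⟩, rfl⟩
    · exact ⟨_, _, rfl, by simp [cyclicTrace], ⟨_, _, _, rfl⟩, rfl⟩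
  -- Each visit to `[1, 0]` is a progress point.
  · obtain ⟨j, hj, hj'⟩ := exists_eq_of_cyclicEdges hedge (k + m)
    obtain ⟨i, rfl⟩ := Nat.exists_eq_add_of_le ((Nat.le_add_right k m).trans hj)
    refine ⟨i, by omega, ?_⟩
    have hc := hcyc i
    unfold IsProgressPoint
    dsimp only
    rw [hunf, ← Nat.add_assoc]
    rw [hj'] at hc ⊢
    generalize ν (k + i + 1) = ν' at hc ⊢
    generalize d (k + i) = d₀ at hc ⊢
    obtain ⟨rfl, rfl⟩ : d₀ = 1 ∧ ν' = [1, 0, 1] := by simpa [cycleEdges] using hc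
    exact ⟨_, _, rfl, hprog⟩

theorem provable_mainSequent (hT : Φ 1 TeF = teFProductions e next TeF)
    (hF : Φ 1 FsT = fsTProductions s next FsT) : Provable Φ (mainSequent s e TeF FsT) :=
  ⟨cyclicProof hT hF, ⟨_, rfl⟩, isProof_cyclicProof hT hF⟩

end CyclicProof

end CLKID

theorem corollary1 :
    (∀ (L : FirstOrder.Language.{u, v}) (I : ℕ → Type w) (Φ : CLKID.DefSet L I)
        (s e : L.Constants) (next : L.Functions 1) (TeF FsT : I 1),
        s ≠ e → TeF ≠ FsT →
        Φ 1 TeF = CLKID.teFProductions e next TeF →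
        Φ 1 FsT = CLKID.fsTProductions s next FsT →
        CLKID.Provable Φ (CLKID.mainSequent s e TeF FsT) ∧
        ¬ CLKID.CutFreeProvable Φ (CLKID.mainSequent s e TeF FsT)) ∧
      ¬ CLKID.CutElimination CLKID.minDefs := by
  refine ⟨fun L I Φ s e next TeF FsT hse hTF hT hF => ⟨CLKID.provable_mainSequent hT hF,
    CLKID.not_cutFreeProvable_mainSequent hse hTF hT hF⟩, fun h => ?_⟩
  exact CLKID.not_cutFreeProvable_mainSequent (Φ := CLKID.minDefs) (s := CLKID.MinFunc.s)
    (e := CLKID.MinFunc.e) (next := CLKID.MinFunc.next) (TeF := CLKID.MinInd.TeF)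
    (FsT := CLKID.MinInd.FsT) nofun nofun rfl rfl (h _ (CLKID.provable_mainSequent rfl rfl))
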